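/- **Theorem (relation with the Loeb measure).** Let $F={}^*\mathbb R$ be a field of hyperreal numbers of Robinson's framework, i.e. an ordered field extension of $\mathbb R$ given with a family of *internal* subsets such that the transfer principle holds: $F$ with its internal subsets is, via the star map, an elementary extension of the structure of all real numbers and all sets of real numbers, in the language with a symbol for every finitary relation between them. Assume that $F$ is sufficiently (that is, countably) saturated: every sequence of internal subsets of $F$ with the finite intersection property has a common point. For $x\in F$ let $\mathrm{st}(x)=\inf\{r\in\mathbb R: x\le r\}\in\mathbb R\cup\{\pm\infty\}$ be its standard part, and let $F_{fin}=\{x\in F: |x|<r \text{ for some } r\in\mathbb R\}$. *The measure $m_L$.* For a bounded interval $I$ of $F$ with endpoints $a\le b$ (open, closed or half-open) put $l_L(I)=\mathrm{st}(b-a)$. For $A\subseteq F$ let $\overline m_L(A)$ be the infimum of $\sum_{n\in\mathbb N} l_L(I_n)$ over all sequences of bounded intervals with $A\subseteq\bigcup_{n} I_n$ ($+\infty$ if there is none). A set is *$L$-measurable* if it belongs to the Carathéodory $\sigma$-algebra $\mathfrak C$ of the outer measure $\overline m_L$, and $m_L$ is the restriction of $\overline m_L$ to $\mathfrak C$. *The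 Loeb measure $\lambda_L$.* Let ${}^*\lambda$ be the nonstandard extension of the Lebesgue measure $\lambda$, defined on the internal ${}^*$Lebesgue measurable subsets of $F$ with values in ${}^*[0,+\infty]$. The Loeb measure $\lambda_L$ is the Carathéodory extension of $S\mapsto \mathrm{st}({}^*\lambda(S))\in[0,+\infty]$: for $A\subseteq F$ one takes the infimum of $\sum_{n\in\mathbb N}\mathrm{st}({}^*\lambda(S_n))$ over all sequences of internal ${}^*$Lebesgue measurable sets with $A\subseteq\bigcup_n S_n$; the Carathéodory $\sigma$-algebra $\mathfrak L$ of this outer measure is the family of *Loeb measurable* sets, and $\lambda_L$ is its restriction to $\mathfrak L$. Then for every $A\subseteq F_{fin}$, if $A\in\mathfrak C$ then $A\in\mathfrak L$, and moreover $m_L(A)=\lambda_L(A)$. -/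

import Mathlib

open MeasureTheory Set
open scoped ENNReal

noncomputable section

/-! ### The real-valued measure on an ordered field extending `ℝ` -/

section RealValuedMeasure

variable {F : Type*} [Field F] [LinearOrder F]

/-- The standard part `inf {r ∈ ℝ : x ≤ r}`, in the extended reals: it is the real number infinitely
close to `x` when `x` is finite, and `+∞` (resp. `-∞`) when `x` is positive (resp. negative)
infinite. The order embedding `j` is the inclusion of `ℝ` in `F`. -/
def shadow (j : ℝ →+*o F) (x : F) : EReal :=
  ⨅ (r : ℝ) (_ : x ≤ j r), (r : EReal)

/-- The ring of finite elements of `F`, as a set. -/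
def finiteElements (j : ℝ →+*o F) : Set F :=
  {x | ∃ r : ℝ, |x| < j r}

/-- `S` is one of the four bounded intervals with endpoints `a` and `b`. -/
def IsIntervalWithEndpoints (S : Set F) (a b : F) : Prop :=
  S = Icc a b ∨ S = Ico a b ∨ S = Ioc a b ∨ S = Ioo a b

/-- The standard part of the length `b - a` of a bounded interval with endpoints `a ≤ b`; sets that
are not bounded intervals get the value `∞`, so that they are of no use in a covering. -/
def lLength (j : ℝ →+*o F) (S : Set F) : ℝ≥0∞ :=
  ⨅ (a : F) (b : F) (_ : a ≤ b) (_ : IsIntervalWithEndpoints S a b), (shadow j (b - a)).toENNReal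

theorem shadow_zero_le (j : ℝ →+*o F) : shadow j 0 ≤ 0 :=
  iInf₂_le_of_le 0 (by simp) (by simp)

theorem lLength_empty (j : ℝ →+*o F) : lLength j (∅ : Set F) = 0 := by
  refine le_antisymm ?_ zero_le
  refine iInf_le_of_le 0 (iInf_le_of_le 0 (iInf_le_of_le le_rfl (iInf_le_of_le ?_ ?_)))
  · exact Or.inr (Or.inr (Or.inr (by simp)))
  · rw [sub_self, EReal.toENNReal_of_nonpos (shadow_zero_le j)]

/-- The outer measure `A ↦ inf {∑ n, lLength (I n) : A ⊆ ⋃ n, I n}`, over all sequences of bounded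
intervals (`∞` if there is no covering of `A`). -/
def lOuterMeasure (j : ℝ →+*o F) : OuterMeasure F :=
  OuterMeasure.ofFunction (lLength j) (lLength_empty j)

/-- `A` is `L`-measurable: it belongs to the Carathéodory `σ`-algebra of the outer measure. -/
def LMeasurableSet (j : ℝ →+*o F) (A : Set F) : Prop :=
  MeasurableSet[(lOuterMeasure j).caratheodory] A

/-- The measure `m_L` on the `σ`-algebra of `L`-measurable sets. -/
def lMeasure (j : ℝ →+*o F) : @Measure F (lOuterMeasure j).caratheodory :=
  @OuterMeasure.toMeasure F (lOuterMeasure j).caratheodory (lOuterMeasure j) le_rfl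

end RealValuedMeasure

/-! ### Hyperreal fields -/

/-- The language with a relation symbol for every finitary relation on `X`. -/
def fullLanguage (X : Type) : FirstOrder.Language where
  Functions := fun _ => Empty
  Relations := fun n => Set (Fin n → X)

/-- In `X` itself every symbol denotes the relation that it is. -/
instance fullStructure (X : Type) : (fullLanguage X).Structure X where
  funMap := fun f _ => Empty.elim f
  RelMap := fun R v => v ∈ (show Set (Fin _ → X) from R)

/-- The standard objects: the real numbers and the sets of real numbers. -/
abbrev StdUniverse : Type := ℝ ⊕ Set ℝ

namespace StdUniverse

/-- The set of (objects that are) real numbers. -/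
def realRel : (fullLanguage StdUniverse).Relations 1 :=
  {v : Fin 1 → StdUniverse | ∃ x : ℝ, v 0 = Sum.inl x}

/-- The graph of the addition of real numbers. -/
def addRel : (fullLanguage StdUniverse).Relations 3 :=
  {v : Fin 3 → StdUniverse | ∃ x y : ℝ,
    v 0 = Sum.inl x ∧ v 1 = Sum.inl y ∧ v 2 = Sum.inl (x + y)}

/-- The graph of the multiplication of real numbers. -/
def mulRel : (fullLanguage StdUniverse).Relations 3 :=
  {v : Fin 3 → StdUniverse | ∃ x y : ℝ,
    v 0 = Sum.inl x ∧ v 1 = Sum.inl y ∧ v 2 = Sum.inl (x * y)}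

/-- The order of the real numbers. -/
def leRel : (fullLanguage StdUniverse).Relations 2 :=
  {v : Fin 2 → StdUniverse | ∃ x y : ℝ, v 0 = Sum.inl x ∧ v 1 = Sum.inl y ∧ x ≤ y}

/-- Membership of a real number in a set of real numbers. -/
def memRel : (fullLanguage StdUniverse).Relations 2 :=
  {v : Fin 2 → StdUniverse | ∃ (x : ℝ) (S : Set ℝ), v 0 = Sum.inl x ∧ v 1 = Sum.inr S ∧ x ∈ S}

/-- The graph of the Lebesgue measure on the Lebesgue measurable sets of finite measure: the pairs
`(S, x)` such that `S` is Lebesgue measurable and its measure is the real number `x`. -/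
def lebesgueRel : (fullLanguage StdUniverse).Relations 2 :=
  {v : Fin 2 → StdUniverse | ∃ (S : Set ℝ) (x : ℝ), v 0 = Sum.inr S ∧ v 1 = Sum.inl x ∧
    NullMeasurableSet S volume ∧ 0 ≤ x ∧ volume S = ENNReal.ofReal x}

end StdUniverse

open FirstOrder FirstOrder.Language StdUniverse

/-- The ordered field `F` as a field `*ℝ` of hyperreal numbers: an elementary extension of the
two-sorted structure `(ℝ, 𝒫(ℝ), ∈, +, ·, ≤, …)`, in the language with a symbol for every finitary
relation between reals and sets of reals (so that the transfer principle holds for all first-order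
properties of reals and sets of reals). Its points are the elements of `F`, its sets are the
internal subsets of `F`, and membership, sum, product and order are the actual ones. -/
structure HyperrealField (F : Type*) [Field F] [LinearOrder F] [IsStrictOrderedRing F] where
  /-- the family `*𝒫(ℝ)` of the internal subsets of `F` -/
  Internal : Set (Set F)
  /-- the nonstandard extensions `*R` of all relations `R` -/
  str : (fullLanguage StdUniverse).Structure (F ⊕ Internal)
  /-- the star map, which satisfies the transfer principle -/
  star : StdUniverse ↪ₑ[fullLanguage StdUniverse] (F ⊕ Internal)
  /-- the inclusion of `ℝ` in `F` -/
  std : ℝ →+*o F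
  star_real : ∀ r : ℝ, star (Sum.inl r) = Sum.inl (std r)
  real_iff : ∀ u : F ⊕ Internal, Structure.RelMap realRel ![u] ↔ ∃ x : F, u = Sum.inl x
  add_iff : ∀ x y z : F,
    Structure.RelMap addRel ![(Sum.inl x : F ⊕ Internal), Sum.inl y, Sum.inl z] ↔ x + y = z
  mul_iff : ∀ x y z : F,
    Structure.RelMap mulRel ![(Sum.inl x : F ⊕ Internal), Sum.inl y, Sum.inl z] ↔ x * y = z
  le_iff : ∀ x y : F,
    Structure.RelMap leRel ![(Sum.inl x : F ⊕ Internal), Sum.inl y] ↔ x ≤ y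
  mem_iff : ∀ (x : F) (S : Internal),
    Structure.RelMap memRel ![(Sum.inl x : F ⊕ Internal), Sum.inr S] ↔ x ∈ (S : Set F)

namespace HyperrealField

variable {F : Type*} [Field F] [LinearOrder F] [IsStrictOrderedRing F]

attribute [instance] HyperrealField.str

/-- Countable (that is, `ℵ₁`-) saturation for internal subsets of `F`: a sequence of internal sets
with the finite intersection property has a common point. -/
def CountablySaturated (H : HyperrealField F) : Prop :=
  ∀ S : ℕ → Set F, (∀ n, S n ∈ H.Internal) → (∀ N, (⋂ n ≤ N, S n).Nonempty) →
    (⋂ n, S n).Nonempty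

/-- `S` is an internal, `*`-Lebesgue measurable set and its measure `*λ(S)`, for the nonstandard
extension `*λ` of the Lebesgue measure, is the (finite or infinite) hyperreal number `x`. -/
def HasStarLebesgueMeasure (H : HyperrealField F) (S : Set F) (x : F) : Prop :=
  ∃ hS : S ∈ H.Internal,
    Structure.RelMap lebesgueRel ![(Sum.inr ⟨S, hS⟩ : F ⊕ H.Internal), Sum.inl x]

/-- The set function `S ↦ st(*λ(S))` on the internal `*`-Lebesgue measurable sets (there is at most
one `x` below). It is `∞` when `*λ(S)` is the infinite value `*∞`, and also, by convention, when `S`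
is not internal and `*`-Lebesgue measurable. -/
def loebContent (H : HyperrealField F) (S : Set F) : ℝ≥0∞ :=
  ⨅ (x : F) (_ : H.HasStarLebesgueMeasure S x), (shadow H.std x).toENNReal

theorem star_empty (H : HyperrealField F) :
    ∃ hS : ∅ ∈ H.Internal, H.star (Sum.inr ∅) = Sum.inr ⟨∅, hS⟩ := by
  have hvec : H.star ∘ ![Sum.inr ∅] = ![H.star (Sum.inr ∅)] := by
    ext1 i
    fin_cases i
    rfl
  have hreal := H.star.map_rel realRel ![Sum.inr ∅]
  rw [hvec, H.real_iff] at hreal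
  have hmem := H.star.map_formula
    (∃' (memRel.boundedFormula₂ (&0) (Term.var (Sum.inl 0))) :
      (fullLanguage StdUniverse).Formula (Fin 1)) ![Sum.inr ∅]
  simp only [Formula.Realize, BoundedFormula.realize_ex, BoundedFormula.realize_rel₂,
    Term.realize_var, Sum.elim_inl, Function.comp_apply, Matrix.cons_val_zero] at hmem
  rcases hs : H.star (Sum.inr ∅) with x | ⟨S, hS⟩
  · obtain ⟨y, hy⟩ := hreal.1 ⟨x, hs⟩
    simp at hy
  · have hempty : S = ∅ := by
      rw [Set.eq_empty_iff_forall_notMem]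
      intro x hx
      obtain ⟨a, ha⟩ := hmem.1 ⟨Sum.inl x, by
        rw [hs]
        exact (H.mem_iff x ⟨S, hS⟩).2 hx⟩
      obtain ⟨y, T, -, h2, h3⟩ := ha
      have h4 : (∅ : Set ℝ) = T := Sum.inr_injective h2
      rw [← h4] at h3
      exact h3
    subst hempty
    exact ⟨hS, rfl⟩

theorem hasStarLebesgueMeasure_empty (H : HyperrealField F) :
    H.HasStarLebesgueMeasure ∅ 0 := by
  obtain ⟨hS, hs⟩ := H.star_empty
  refine ⟨hS, ?_⟩
  have hvec : H.star ∘ ![Sum.inr ∅, Sum.inl 0] = ![Sum.inr ⟨∅, hS⟩, Sum.inl 0] := by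
    ext1 i
    fin_cases i
    · exact hs
    · exact (H.star_real 0).trans (by rw [map_zero]; rfl)
  have h := H.star.map_rel lebesgueRel ![Sum.inr ∅, Sum.inl 0]
  rw [hvec] at h
  exact h.2 ⟨∅, 0, rfl, rfl, MeasurableSet.empty.nullMeasurableSet, le_rfl, by simp⟩

theorem loebContent_empty (H : HyperrealField F) : H.loebContent ∅ = 0 := by
  refine le_antisymm ?_ zero_le
  refine iInf₂_le_of_le 0 H.hasStarLebesgueMeasure_empty ?_
  rw [EReal.toENNReal_of_nonpos (shadow_zero_le H.std)]

/-- The outer measure `A ↦ inf {∑ n, st(*λ(S n)) : A ⊆ ⋃ n, S n}`, over all sequences of internal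
`*`-Lebesgue measurable sets. -/
def loebOuterMeasure (H : HyperrealField F) : OuterMeasure F :=
  OuterMeasure.ofFunction H.loebContent H.loebContent_empty

/-- `A` is Loeb measurable, for the Loeb measure of the Lebesgue measure. -/
def LoebMeasurableSet (H : HyperrealField F) (A : Set F) : Prop :=
  MeasurableSet[H.loebOuterMeasure.caratheodory] A

/-- The Loeb measure of the Lebesgue measure: the Carathéodory extension of `S ↦ st(*λ(S))`. -/
def loebMeasure (H : HyperrealField F) : @Measure F H.loebOuterMeasure.caratheodory :=
  @OuterMeasure.toMeasure F H.loebOuterMeasure.caratheodory H.loebOuterMeasure le_rfl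

end HyperrealField

end

/-! Closed intervals are internal, with `*`measure equal to their length, so a covering by intervals
gives a covering by internal sets at the same cost: the Loeb outer measure λ is at most the interval
outer measure m (`loebOuterMeasure_le_lOuterMeasure`). In the other direction, saturation lets
finitely many members of a countable internal covering cover an internal set, whence λ(J) ≥ st(b -
a) ≥ m(J) for J = [a, b).

These bounds force equality below J when its endpoints are standard. If A ⊆ J is `L`-measurable,
then λ(A) + λ(J \ A) ≤ m(A) + m(J \ A) = m(J) ≤ λ(J) ≤ λ(A) + λ(J \ A), all finite. So m(A) = λ(A),
and A splits J additively for λ, which makes A Loeb measurable (`LoebMeasurableSet.of_add_le`). The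
intervals [-n, n) exhaust the finite elements, and continuity from below concludes. -/

open FirstOrder FirstOrder.Language StdUniverse

namespace HyperrealField
variable {F : Type*} [Field F] [LinearOrder F] [IsStrictOrderedRing F]

/-- The transfer principle for sentences. -/
theorem transfer (H : HyperrealField F) (φ : (fullLanguage StdUniverse).Sentence)
    (h : StdUniverse ⊨ φ) : (F ⊕ H.Internal) ⊨ φ :=
  (H.star.map_sentence φ).1 h

/-! ### First-order sentences about the Lebesgue measure -/

section Realize

variable (M : Type*) [(fullLanguage StdUniverse).Structure M]

variable {M} in
theorem realize_rel₃ {α : Type*} {n : ℕ} (R : (fullLanguage StdUniverse).Relations 3)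
    (t₁ t₂ t₃ : (fullLanguage StdUniverse).Term (α ⊕ Fin n)) (v : α → M) (xs : Fin n → M) :
    (R.boundedFormula ![t₁, t₂, t₃]).Realize v xs ↔ Structure.RelMap R
      ![t₁.realize (Sum.elim v xs), t₂.realize (Sum.elim v xs), t₃.realize (Sum.elim v xs)] := by
  rw [BoundedFormula.realize_rel]
  refine iff_of_eq (congrArg _ (funext fun i => ?_))
  fin_cases i <;> rfl

/-- The difference of two sets is a set. -/
def diffSentence : (fullLanguage StdUniverse).Sentence :=
  ∀' ∀' (∼(realRel.boundedFormula₁ (&0)) ⟹ ∼(realRel.boundedFormula₁ (&1)) ⟹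
    ∃' (∼(realRel.boundedFormula₁ (&2)) ⊓
      ∀' (memRel.boundedFormula₂ (&3) (&2) ⇔
        (memRel.boundedFormula₂ (&3) (&0) ⊓ ∼(memRel.boundedFormula₂ (&3) (&1))))))

/-- Quantifiers range over reals and sets alike; `realRel` tells the sorts apart. -/
theorem realize_diffSentence : M ⊨ diffSentence ↔
    ∀ S T : M, ¬ Structure.RelMap realRel ![S] → ¬ Structure.RelMap realRel ![T] →
      ∃ U : M, ¬ Structure.RelMap realRel ![U] ∧ ∀ z : M, Structure.RelMap memRel ![z, U] ↔
        Structure.RelMap memRel ![z, S] ∧ ¬ Structure.RelMap memRel ![z, T] := by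
  simp [diffSentence, Sentence.Realize, Formula.Realize, Fin.snoc, BoundedFormula.realize_rel₁,
    BoundedFormula.realize_rel₂]

/-- A set of finite measure is split additively by a measurable set. -/
def splitSentence : (fullLanguage StdUniverse).Sentence :=
  ∀' ∀' ∀' ∀' (lebesgueRel.boundedFormula₂ (&0) (&1) ⟹ lebesgueRel.boundedFormula₂ (&2) (&3) ⟹
    ∃' ∃' ∃' ∃' (∼(realRel.boundedFormula₁ (&4)) ⊓ realRel.boundedFormula₁ (&5) ⊓
      ∼(realRel.boundedFormula₁ (&6)) ⊓ realRel.boundedFormula₁ (&7) ⊓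
      lebesgueRel.boundedFormula₂ (&4) (&5) ⊓ lebesgueRel.boundedFormula₂ (&6) (&7) ⊓
      addRel.boundedFormula ![&5, &7, &1] ⊓
      ∀' (memRel.boundedFormula₂ (&8) (&4) ⇔
        (memRel.boundedFormula₂ (&8) (&0) ⊓ memRel.boundedFormula₂ (&8) (&2))) ⊓
      ∀' (memRel.boundedFormula₂ (&8) (&6) ⇔
        (memRel.boundedFormula₂ (&8) (&0) ⊓ ∼(memRel.boundedFormula₂ (&8) (&2))))))

theorem realize_splitSentence : M ⊨ splitSentence ↔
    ∀ S x T y : M, Structure.RelMap lebesgueRel ![S, x] → Structure.RelMap lebesgueRel ![T, y] →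
      ∃ U u V v : M, ((((((((¬ Structure.RelMap realRel ![U]) ∧ Structure.RelMap realRel ![u]) ∧
        ¬ Structure.RelMap realRel ![V]) ∧ Structure.RelMap realRel ![v]) ∧
        Structure.RelMap lebesgueRel ![U, u]) ∧ Structure.RelMap lebesgueRel ![V, v]) ∧
        Structure.RelMap addRel ![u, v, x]) ∧
        (∀ z : M, Structure.RelMap memRel ![z, U] ↔
          Structure.RelMap memRel ![z, S] ∧ Structure.RelMap memRel ![z, T])) ∧
        ∀ z : M, Structure.RelMap memRel ![z, V] ↔
          Structure.RelMap memRel ![z, S] ∧ ¬ Structure.RelMap memRel ![z, T] := by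
  simp [splitSentence, Sentence.Realize, Formula.Realize, Fin.snoc, BoundedFormula.realize_rel₁,
    BoundedFormula.realize_rel₂, realize_rel₃,
    -BoundedFormula.realize_rel]

/-- The Lebesgue measure is monotone. -/
def leSentence : (fullLanguage StdUniverse).Sentence :=
  ∀' ∀' ∀' ∀' (lebesgueRel.boundedFormula₂ (&0) (&1) ⟹ lebesgueRel.boundedFormula₂ (&2) (&3) ⟹
    ∀' (realRel.boundedFormula₁ (&4) ⟹ memRel.boundedFormula₂ (&4) (&0) ⟹
      memRel.boundedFormula₂ (&4) (&2)) ⟹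
    leRel.boundedFormula₂ (&1) (&3))

/-- Inclusion is tested on points only, because `mem_iff` fixes the meaning of membership only for
points. -/
theorem realize_leSentence : M ⊨ leSentence ↔
    ∀ S x T y : M, Structure.RelMap lebesgueRel ![S, x] → Structure.RelMap lebesgueRel ![T, y] →
      (∀ z : M, Structure.RelMap realRel ![z] → Structure.RelMap memRel ![z, S] →
        Structure.RelMap memRel ![z, T]) → Structure.RelMap leRel ![x, y] := by
  simp [leSentence, Sentence.Realize, Formula.Realize, Fin.snoc, BoundedFormula.realize_rel₁,
    BoundedFormula.realize_rel₂]

/-- The Lebesgue measure is subadditive. -/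
def unionSentence : (fullLanguage StdUniverse).Sentence :=
  ∀' ∀' ∀' ∀' (lebesgueRel.boundedFormula₂ (&0) (&1) ⟹ lebesgueRel.boundedFormula₂ (&2) (&3) ⟹
    ∃' ∃' ∃' (∼(realRel.boundedFormula₁ (&4)) ⊓ realRel.boundedFormula₁ (&5) ⊓
      realRel.boundedFormula₁ (&6) ⊓ lebesgueRel.boundedFormula₂ (&4) (&5) ⊓
      addRel.boundedFormula ![&1, &3, &6] ⊓ leRel.boundedFormula₂ (&5) (&6) ⊓
      ∀' (memRel.boundedFormula₂ (&7) (&4) ⇔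
        (memRel.boundedFormula₂ (&7) (&0) ⊔ memRel.boundedFormula₂ (&7) (&2)))))

theorem realize_unionSentence : M ⊨ unionSentence ↔
    ∀ S x T y : M, Structure.RelMap lebesgueRel ![S, x] → Structure.RelMap lebesgueRel ![T, y] →
      ∃ U u w : M, (((((¬ Structure.RelMap realRel ![U] ∧ Structure.RelMap realRel ![u]) ∧
        Structure.RelMap realRel ![w]) ∧ Structure.RelMap lebesgueRel ![U, u]) ∧
        Structure.RelMap addRel ![x, y, w]) ∧ Structure.RelMap leRel ![u, w]) ∧
        ∀ z : M, Structure.RelMap memRel ![z, U] ↔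
          Structure.RelMap memRel ![z, S] ∨ Structure.RelMap memRel ![z, T] := by
  simp [unionSentence, Sentence.Realize, Formula.Realize, Fin.snoc, BoundedFormula.realize_rel₁,
    BoundedFormula.realize_rel₂, realize_rel₃,
    -BoundedFormula.realize_rel]

/-- The interval `[a, b]` is a set of measure `b - a`. -/
def intervalSentence : (fullLanguage StdUniverse).Sentence :=
  ∀' ∀' (leRel.boundedFormula₂ (&0) (&1) ⟹
    ∃' ∃' (∼(realRel.boundedFormula₁ (&2)) ⊓ realRel.boundedFormula₁ (&3) ⊓
      lebesgueRel.boundedFormula₂ (&2) (&3) ⊓ addRel.boundedFormula ![&0, &3, &1] ⊓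
      ∀' (memRel.boundedFormula₂ (&4) (&2) ⇔
        (leRel.boundedFormula₂ (&0) (&4) ⊓ leRel.boundedFormula₂ (&4) (&1)))))

theorem realize_intervalSentence : M ⊨ intervalSentence ↔
    ∀ a b : M, Structure.RelMap leRel ![a, b] →
      ∃ U u : M, (((¬ Structure.RelMap realRel ![U] ∧ Structure.RelMap realRel ![u]) ∧
        Structure.RelMap lebesgueRel ![U, u]) ∧ Structure.RelMap addRel ![a, u, b]) ∧
        ∀ z : M, Structure.RelMap memRel ![z, U] ↔
          Structure.RelMap leRel ![a, z] ∧ Structure.RelMap leRel ![z, b] := by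
  simp [intervalSentence, Sentence.Realize, Formula.Realize, Fin.snoc,
    BoundedFormula.realize_rel₁, BoundedFormula.realize_rel₂, realize_rel₃,
    -BoundedFormula.realize_rel]

end Realize
-- Truth of these sentences for the real numbers
section Standard

theorem std_realRel (u : StdUniverse) :
    Structure.RelMap realRel ![u] ↔ ∃ x : ℝ, u = Sum.inl x := Iff.rfl

theorem std_addRel (u v w : StdUniverse) :
    Structure.RelMap addRel ![u, v, w] ↔
      ∃ x y : ℝ, u = Sum.inl x ∧ v = Sum.inl y ∧ w = Sum.inl (x + y) := Iff.rfl

theorem std_leRel (u v : StdUniverse) :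
    Structure.RelMap leRel ![u, v] ↔ ∃ x y : ℝ, u = Sum.inl x ∧ v = Sum.inl y ∧ x ≤ y := Iff.rfl

theorem std_memRel (u v : StdUniverse) :
    Structure.RelMap memRel ![u, v] ↔
      ∃ (x : ℝ) (S : Set ℝ), u = Sum.inl x ∧ v = Sum.inr S ∧ x ∈ S := Iff.rfl

theorem std_lebesgueRel (u v : StdUniverse) :
    Structure.RelMap lebesgueRel ![u, v] ↔ ∃ (S : Set ℝ) (x : ℝ), u = Sum.inr S ∧ v = Sum.inl x ∧
      NullMeasurableSet S volume ∧ 0 ≤ x ∧ volume S = ENNReal.ofReal x := Iff.rfl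

theorem std_diffSentence : StdUniverse ⊨ diffSentence := by
  rw [realize_diffSentence]
  simp only [std_realRel, std_memRel]
  rintro (S | S) (T | T) hS hT
  · exact (hS ⟨S, rfl⟩).elim
  · exact (hS ⟨S, rfl⟩).elim
  · exact (hT ⟨T, rfl⟩).elim
  · refine ⟨Sum.inr (S \ T), by simp, ?_⟩
    rintro (z | z) <;> simp

theorem std_splitSentence : StdUniverse ⊨ splitSentence := by
  rw [realize_splitSentence]
  rintro _ _ _ _ ⟨S, x, rfl, rfl, hS, hx, hSx⟩ ⟨T, y, rfl, rfl, hT, hy, hTy⟩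
  have hfin : volume S ≠ ∞ := by simp [hSx]
  have h1 : volume (S ∩ T) ≠ ∞ := measure_ne_top_of_subset inter_subset_left hfin
  have h2 : volume (S \ T) ≠ ∞ := measure_ne_top_of_subset sdiff_subset hfin
  refine ⟨Sum.inr (S ∩ T), Sum.inl (volume (S ∩ T)).toReal, Sum.inr (S \ T),
    Sum.inl (volume (S \ T)).toReal, ?_⟩
  have hadd : x = (volume (S ∩ T)).toReal + (volume (S \ T)).toReal := by
    rw [← ENNReal.toReal_add h1 h2, measure_inter_add_sdiff₀ S hT, hSx, ENNReal.toReal_ofReal hx]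
  simp only [std_realRel, std_memRel, std_lebesgueRel, std_addRel]
  refine ⟨⟨⟨⟨⟨⟨⟨⟨by simp, by simp⟩, by simp⟩, by simp⟩, _, _, rfl, rfl, hS.inter hT,
    ENNReal.toReal_nonneg, (ENNReal.ofReal_toReal h1).symm⟩, _, _, rfl, rfl, hS.diff hT,
    ENNReal.toReal_nonneg, (ENNReal.ofReal_toReal h2).symm⟩, _, _, rfl, rfl, by rw [hadd]⟩, ?_⟩, ?_⟩
  · rintro (z | z) <;> simp
  · rintro (z | z) <;> simp

theorem std_leSentence : StdUniverse ⊨ leSentence := by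
  rw [realize_leSentence]
  rintro _ _ _ _ ⟨S, x, rfl, rfl, hS, hx, hSx⟩ ⟨T, y, rfl, rfl, hT, hy, hTy⟩ h
  simp only [std_realRel, std_memRel] at h
  have hST : S ⊆ T := fun z hz => by simpa using h (Sum.inl z) ⟨z, rfl⟩ (by simpa using hz)
  refine ⟨x, y, rfl, rfl, ?_⟩
  rw [← ENNReal.ofReal_le_ofReal_iff hy, ← hSx, ← hTy]
  exact measure_mono hST

theorem std_unionSentence : StdUniverse ⊨ unionSentence := by
  rw [realize_unionSentence]
  rintro _ _ _ _ ⟨S, x, rfl, rfl, hS, hx, hSx⟩ ⟨T, y, rfl, rfl, hT, hy, hTy⟩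
  have hle : volume (S ∪ T) ≤ ENNReal.ofReal (x + y) := by
    rw [ENNReal.ofReal_add hx hy, ← hSx, ← hTy]
    exact measure_union_le S T
  have hfin : volume (S ∪ T) ≠ ∞ := ne_top_of_le_ne_top ENNReal.ofReal_ne_top hle
  refine ⟨Sum.inr (S ∪ T), Sum.inl (volume (S ∪ T)).toReal, Sum.inl (x + y), ?_⟩
  simp only [std_realRel, std_memRel, std_lebesgueRel, std_addRel, std_leRel]
  refine ⟨⟨⟨⟨⟨⟨by simp, by simp⟩, by simp⟩, _, _, rfl, rfl, hS.union hT,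
    ENNReal.toReal_nonneg, (ENNReal.ofReal_toReal hfin).symm⟩, _, _, rfl, rfl, rfl⟩,
    _, _, rfl, rfl, ENNReal.toReal_le_of_le_ofReal (add_nonneg hx hy) hle⟩, ?_⟩
  rintro (z | z) <;> simp

theorem std_intervalSentence : StdUniverse ⊨ intervalSentence := by
  rw [realize_intervalSentence]
  rintro _ _ ⟨a, b, rfl, rfl, hab⟩
  refine ⟨Sum.inr (Icc a b), Sum.inl (b - a), ?_⟩
  simp only [std_realRel, std_memRel, std_lebesgueRel, std_addRel, std_leRel]
  refine ⟨⟨⟨⟨by simp, by simp⟩, _, _, rfl, rfl, measurableSet_Icc.nullMeasurableSet,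
    sub_nonneg.2 hab, Real.volume_Icc⟩, _, _, rfl, rfl, by simp⟩, ?_⟩
  rintro (z | z) <;> simp

end Standard

/-! ### The `*`Lebesgue measure, by transfer -/

variable (H : HyperrealField F)

theorem relMap_realRel_inl (x : F) :
    Structure.RelMap realRel ![(Sum.inl x : F ⊕ H.Internal)] :=
  (H.real_iff _).2 ⟨x, rfl⟩

theorem not_relMap_realRel_inr (S : H.Internal) :
    ¬ Structure.RelMap realRel ![(Sum.inr S : F ⊕ H.Internal)] := by
  rw [H.real_iff]
  simp

theorem exists_inr_of_not_relMap_realRel {u : F ⊕ H.Internal}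
    (h : ¬ Structure.RelMap realRel ![u]) : ∃ S, ∃ hS : S ∈ H.Internal, u = Sum.inr ⟨S, hS⟩ := by
  rcases u with x | S
  · exact absurd (H.relMap_realRel_inl x) h
  · exact ⟨S, S.2, rfl⟩

variable {H}

theorem diff_mem_internal {S T : Set F} (hS : S ∈ H.Internal) (hT : T ∈ H.Internal) :
    S \ T ∈ H.Internal := by
  obtain ⟨U, hU, h⟩ := (realize_diffSentence _).1 (H.transfer _ std_diffSentence)
    (Sum.inr ⟨S, hS⟩) (Sum.inr ⟨T, hT⟩) (H.not_relMap_realRel_inr _) (H.not_relMap_realRel_inr _)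
  obtain ⟨U, hU', rfl⟩ := H.exists_inr_of_not_relMap_realRel hU
  convert hU'
  ext z
  simpa only [H.mem_iff, mem_sdiff] using (h (Sum.inl z)).symm

theorem HasStarLebesgueMeasure.split {S T : Set F} {x y : F} (hS : H.HasStarLebesgueMeasure S x)
    (hT : H.HasStarLebesgueMeasure T y) : ∃ u v, H.HasStarLebesgueMeasure (S ∩ T) u ∧
      H.HasStarLebesgueMeasure (S \ T) v ∧ u + v = x := by
  obtain ⟨hSi, hS⟩ := hS
  obtain ⟨hTi, hT⟩ := hT
  obtain ⟨U, u, V, v, ⟨⟨⟨⟨⟨⟨⟨⟨hU, hu⟩, hV⟩, hv⟩, hUu⟩, hVv⟩, hadd⟩, hmU⟩, hmV⟩⟩ :=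
    (realize_splitSentence _).1 (H.transfer _ std_splitSentence) _ _ _ _ hS hT
  obtain ⟨U, hUi, rfl⟩ := H.exists_inr_of_not_relMap_realRel hU
  obtain ⟨V, hVi, rfl⟩ := H.exists_inr_of_not_relMap_realRel hV
  obtain ⟨u, rfl⟩ := (H.real_iff u).1 hu
  obtain ⟨v, rfl⟩ := (H.real_iff v).1 hv
  have hU : U = S ∩ T := by
    ext z
    simpa only [H.mem_iff, mem_inter_iff] using hmU (Sum.inl z)
  have hV : V = S \ T := by
    ext z
    simpa only [H.mem_iff, mem_sdiff] using hmV (Sum.inl z)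
  subst hU hV
  exact ⟨u, v, ⟨hUi, hUu⟩, ⟨hVi, hVv⟩, (H.add_iff _ _ _).1 hadd⟩

theorem HasStarLebesgueMeasure.mono {S T : Set F} {x y : F} (hS : H.HasStarLebesgueMeasure S x)
    (hT : H.HasStarLebesgueMeasure T y) (h : S ⊆ T) : x ≤ y := by
  obtain ⟨hSi, hS⟩ := hS
  obtain ⟨hTi, hT⟩ := hT
  refine (H.le_iff _ _).1 ((realize_leSentence _).1 (H.transfer _ std_leSentence) _ _ _ _ hS hT ?_)
  intro z hz
  obtain ⟨z, rfl⟩ := (H.real_iff z).1 hz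
  simpa only [H.mem_iff] using fun hz => h hz

theorem HasStarLebesgueMeasure.union {S T : Set F} {x y : F} (hS : H.HasStarLebesgueMeasure S x)
    (hT : H.HasStarLebesgueMeasure T y) :
    ∃ u, H.HasStarLebesgueMeasure (S ∪ T) u ∧ u ≤ x + y := by
  obtain ⟨hSi, hS⟩ := hS
  obtain ⟨hTi, hT⟩ := hT
  obtain ⟨U, u, w, ⟨⟨⟨⟨⟨⟨hU, hu⟩, hw⟩, hUu⟩, hadd⟩, hle⟩, hmU⟩⟩ :=
    (realize_unionSentence _).1 (H.transfer _ std_unionSentence) _ _ _ _ hS hT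
  obtain ⟨U, hUi, rfl⟩ := H.exists_inr_of_not_relMap_realRel hU
  obtain ⟨u, rfl⟩ := (H.real_iff u).1 hu
  obtain ⟨w, rfl⟩ := (H.real_iff w).1 hw
  have hU : U = S ∪ T := by
    ext z
    simpa only [H.mem_iff, mem_union] using hmU (Sum.inl z)
  subst hU
  exact ⟨u, ⟨hUi, hUu⟩, ((H.le_iff _ _).1 hle).trans_eq ((H.add_iff _ _ _).1 hadd).symm⟩

variable (H) in
theorem hasStarLebesgueMeasure_Icc {a b : F} (hab : a ≤ b) :
    H.HasStarLebesgueMeasure (Icc a b) (b - a) := by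
  obtain ⟨U, u, ⟨⟨⟨⟨hU, hu⟩, hUu⟩, hadd⟩, hmU⟩⟩ :=
    (realize_intervalSentence _).1 (H.transfer _ std_intervalSentence) _ _ ((H.le_iff a b).2 hab)
  obtain ⟨U, hUi, rfl⟩ := H.exists_inr_of_not_relMap_realRel hU
  obtain ⟨u, rfl⟩ := (H.real_iff u).1 hu
  have hU : U = Icc a b := by
    ext z
    simpa only [H.mem_iff, H.le_iff, mem_Icc] using hmU (Sum.inl z)
  subst hU
  rw [sub_eq_of_eq_add' ((H.add_iff _ _ _).1 hadd).symm]
  exact ⟨hUi, hUu⟩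

theorem HasStarLebesgueMeasure.nonneg {S : Set F} {x : F} (hS : H.HasStarLebesgueMeasure S x) :
    0 ≤ x :=
  H.hasStarLebesgueMeasure_empty.mono hS (empty_subset _)

theorem HasStarLebesgueMeasure.unique {S : Set F} {x y : F} (hx : H.HasStarLebesgueMeasure S x)
    (hy : H.HasStarLebesgueMeasure S y) : x = y :=
  le_antisymm (hx.mono hy Subset.rfl) (hy.mono hx Subset.rfl)

end HyperrealField

/-! ### Standard parts and the interval outer measure -/

section Shadow

variable {F : Type*} [Field F] [LinearOrder F] (j : ℝ →+*o F)

theorem toENNReal_shadow_le {x : F} {r : ℝ} (h : x ≤ j r) :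
    (shadow j x).toENNReal ≤ ENNReal.ofReal r := by
  have : shadow j x ≤ r := iInf₂_le r h
  simpa using EReal.toENNReal_le_toENNReal this

/-- Strictness matters: for r ≥ 0, an x above `j r` by a positive infinitesimal still has standard
part r. -/
theorem le_of_toENNReal_shadow_lt {x : F} {r : ℝ} (h : (shadow j x).toENNReal < ENNReal.ofReal r) :
    x ≤ j r := by
  have h1 : shadow j x < r := by
    by_contra! hr
    exact h.not_ge (by simpa using EReal.toENNReal_le_toENNReal hr)
  obtain ⟨s, hs⟩ := iInf_lt_iff.1 h1
  obtain ⟨hxs, hsr⟩ := iInf_lt_iff.1 hs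
  exact hxs.trans (OrderHomClass.mono j (by exact_mod_cast hsr.le))

theorem lt_of_lt_toENNReal_shadow {x : F} {r : NNReal} (h : (r : ℝ≥0∞) < (shadow j x).toENNReal) :
    j r < x := by
  by_contra! hx
  exact h.not_ge (by simpa using toENNReal_shadow_le j hx)

theorem toENNReal_shadow_mono {x y : F} (h : x ≤ y) :
    (shadow j x).toENNReal ≤ (shadow j y).toENNReal :=
  EReal.toENNReal_le_toENNReal (le_iInf₂ fun r hr => iInf₂_le r (h.trans hr))

theorem toENNReal_shadow_zero : (shadow j 0).toENNReal = 0 :=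
  EReal.toENNReal_of_nonpos (shadow_zero_le j)

theorem ofReal_le_toENNReal_shadow (r : ℝ) : ENNReal.ofReal r ≤ (shadow j (j r)).toENNReal := by
  have : (r : EReal) ≤ shadow j (j r) :=
    le_iInf₂ fun s hs => by
      by_contra! h
      exact hs.not_gt ((OrderHomClass.mono j).strictMono_of_injective j.toRingHom.injective
        (by exact_mod_cast h))
  simpa using EReal.toENNReal_le_toENNReal this

theorem lLength_le {S : Set F} {a b : F} (hab : a ≤ b) (h : IsIntervalWithEndpoints S a b) :
    lLength j S ≤ (shadow j (b - a)).toENNReal :=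
  iInf_le_of_le a (iInf_le_of_le b (iInf_le_of_le hab (iInf_le _ h)))

theorem lOuterMeasure_Ico_le {a b : F} (hab : a ≤ b) :
    lOuterMeasure j (Ico a b) ≤ (shadow j (b - a)).toENNReal :=
  (OuterMeasure.ofFunction_le _).trans (lLength_le j hab (Or.inr (Or.inl rfl)))

variable [IsStrictOrderedRing F]

theorem toENNReal_shadow_add_le (x y : F) :
    (shadow j (x + y)).toENNReal ≤ (shadow j x).toENNReal + (shadow j y).toENNReal := by
  refine ENNReal.le_of_forall_pos_le_add fun ε hε htop => ?_
  obtain ⟨hx, hy⟩ := ENNReal.add_lt_top.1 htop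
  -- The slack ε / 2 absorbs a possible infinitesimal excess of z over its standard part.
  have key : ∀ z : F, (shadow j z).toENNReal < ∞ →
      z ≤ j ((shadow j z).toENNReal.toReal + (ε / 2 : NNReal)) := fun z hz =>
    le_of_toENNReal_shadow_lt j <| by
      rw [ENNReal.ofReal_add ENNReal.toReal_nonneg (NNReal.coe_nonneg _),
        ENNReal.ofReal_toReal hz.ne, ENNReal.ofReal_coe_nnreal]
      exact ENNReal.lt_add_right hz.ne (by simpa using hε.ne')
  have h := toENNReal_shadow_le j ((add_le_add (key x hx) (key y hy)).trans_eq (map_add j _ _).symm)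
  refine h.trans_eq ?_
  rw [add_add_add_comm, ← NNReal.coe_add, add_halves, ENNReal.ofReal_add (by positivity)
    (NNReal.coe_nonneg _), ENNReal.ofReal_add (by positivity) (by positivity),
    ENNReal.ofReal_toReal hx.ne, ENNReal.ofReal_toReal hy.ne, ENNReal.ofReal_coe_nnreal]

theorem toENNReal_shadow_sum_le (x : ℕ → F) (s : Finset ℕ) :
    (shadow j (∑ i ∈ s, x i)).toENNReal ≤ ∑ i ∈ s, (shadow j (x i)).toENNReal :=
  Finset.le_sum_of_subadditive (fun y => (shadow j y).toENNReal) (toENNReal_shadow_zero j).le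
    (toENNReal_shadow_add_le j) s x

/-- The standard part is superadditive on nonnegative elements. -/
theorem add_toENNReal_shadow_le {x y : F} (hx : 0 ≤ x) (hy : 0 ≤ y) :
    (shadow j x).toENNReal + (shadow j y).toENNReal ≤ (shadow j (x + y)).toENNReal := by
  have hxle := toENNReal_shadow_mono j (le_add_of_nonneg_right hy : x ≤ x + y)
  have hyle := toENNReal_shadow_mono j (le_add_of_nonneg_left hx : y ≤ x + y)
  rcases eq_or_ne (shadow j (x + y)).toENNReal ∞ with htop | htop
  · rw [htop]
    exact le_top
  -- Reals a < st x and b < st y satisfy `j (a + b) ≤ x + y`; take suprema over a and b. The bounds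
  -- from nonnegativity make truncated subtraction reversible.
  refine add_le_of_le_tsub_right_of_le hyle (ENNReal.le_of_forall_nnreal_lt fun a ha => ?_)
  refine ENNReal.le_sub_of_add_le_right (ne_top_of_le_ne_top htop hyle) ?_
  refine add_le_of_le_tsub_left_of_le (ha.le.trans hxle)
    (ENNReal.le_of_forall_nnreal_lt fun b hb => ?_)
  refine ENNReal.le_sub_of_add_le_left ENNReal.coe_ne_top ?_
  have h : j ((a + b : NNReal) : ℝ) ≤ x + y := by
    rw [NNReal.coe_add, map_add]
    exact (add_lt_add (lt_of_lt_toENNReal_shadow j ha) (lt_of_lt_toENNReal_shadow j hb)).le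
  simpa only [ENNReal.ofReal_coe_nnreal, ENNReal.coe_add] using
    (ofReal_le_toENNReal_shadow j (a + b : NNReal)).trans (toENNReal_shadow_mono j h)

/-- Cutting a covering interval at c leaves two intervals whose lengths add up to the original one,
and standard parts of nonnegative lengths are superadditive. -/
theorem lMeasurableSet_Ici (c : F) : LMeasurableSet j (Ici c) := by
  refine OuterMeasure.ofFunction_caratheodory fun t => ?_
  refine le_iInf fun a => le_iInf fun b => le_iInf fun hab => le_iInf fun ht => ?_
  rcases le_or_gt c a with hca | hac
  · have hsub : t ⊆ Ici c := by
      rcases ht with rfl | rfl | rfl | rfl <;> intro z hz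
      · exact hca.trans hz.1
      · exact hca.trans hz.1
      · exact hca.trans hz.1.le
      · exact hca.trans hz.1.le
    rw [inter_eq_left.2 hsub, sdiff_eq_empty.2 hsub, lLength_empty, add_zero]
    exact lLength_le j hab ht
  rcases lt_or_ge b c with hbc | hcb
  · have hdis : Disjoint t (Ici c) := by
      rw [Set.disjoint_left]
      rintro z hz (hcz : c ≤ z)
      have hzb : z ≤ b := by
        rcases ht with rfl | rfl | rfl | rfl
        · exact hz.2
        · exact hz.2.le
        · exact hz.2
        · exact hz.2.le
      exact (hcz.trans hzb).not_gt hbc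
    rw [hdis.inter_eq, hdis.sdiff_eq_left, lLength_empty, zero_add]
    exact lLength_le j hab ht
  have h1 : IsIntervalWithEndpoints (t ∩ Ici c) c b := by
    have key : ∀ z : F, c ≤ z → a < z := fun z hz => hac.trans_le hz
    rcases ht with rfl | rfl | rfl | rfl
    · refine Or.inl ?_
      ext z; simp only [mem_inter_iff, mem_Icc, mem_Ici]; grind
    · refine Or.inr (Or.inl ?_)
      ext z; simp only [mem_inter_iff, mem_Ico, mem_Ici]; grind
    · refine Or.inl ?_
      ext z; simp only [mem_inter_iff, mem_Ioc, mem_Icc, mem_Ici]; grind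
    · refine Or.inr (Or.inl ?_)
      ext z; simp only [mem_inter_iff, mem_Ioo, mem_Ico, mem_Ici]; grind
  have h2 : IsIntervalWithEndpoints (t \ Ici c) a c := by
    rcases ht with rfl | rfl | rfl | rfl
    · refine Or.inr (Or.inl ?_)
      ext z; simp only [mem_sdiff, mem_Icc, mem_Ico, mem_Ici]; grind
    · refine Or.inr (Or.inl ?_)
      ext z; simp only [mem_sdiff, mem_Ico, mem_Ici]; grind
    · refine Or.inr (Or.inr (Or.inr ?_))
      ext z; simp only [mem_sdiff, mem_Ioc, mem_Ioo, mem_Ici]; grind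
    · refine Or.inr (Or.inr (Or.inr ?_))
      ext z; simp only [mem_sdiff, mem_Ioo, mem_Ici]; grind
  calc lLength j (t ∩ Ici c) + lLength j (t \ Ici c)
      ≤ (shadow j (b - c)).toENNReal + (shadow j (c - a)).toENNReal :=
        add_le_add (lLength_le j hcb h1) (lLength_le j hac.le h2)
    _ ≤ (shadow j (b - c + (c - a))).toENNReal :=
        add_toENNReal_shadow_le j (sub_nonneg.2 hcb) (sub_nonneg.2 hac.le)
    _ = (shadow j (b - a)).toENNReal := by rw [sub_add_sub_cancel]

theorem lMeasurableSet_Ico (a b : F) : LMeasurableSet j (Ico a b) := by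
  rw [← Ici_sdiff_Ici]
  exact MeasurableSet.diff (lMeasurableSet_Ici j a) (lMeasurableSet_Ici j b)

theorem finiteElements_subset_iUnion_Ico (j : ℝ →+*o F) :
    finiteElements j ⊆ ⋃ n : ℕ, Ico (j (-n)) (j n) := by
  rintro x ⟨r, hr⟩
  obtain ⟨n, hn⟩ := exists_nat_ge r
  have h := abs_lt.1 (hr.trans_le (OrderHomClass.mono j hn))
  exact mem_iUnion.2 ⟨n, by rw [map_neg]; exact h.1.le, h.2⟩

end Shadow

/-! ### The Loeb outer measure and its measurable sets -/

namespace HyperrealField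

variable {F : Type*} [Field F] [LinearOrder F] [IsStrictOrderedRing F] {H : HyperrealField F}

theorem loebContent_eq {S : Set F} {x : F} (h : H.HasStarLebesgueMeasure S x) :
    H.loebContent S = (shadow H.std x).toENNReal :=
  le_antisymm (iInf₂_le x h) (le_iInf₂ fun _ hy => by rw [h.unique hy])

theorem exists_hasStarLebesgueMeasure {S : Set F} (h : H.loebContent S ≠ ∞) :
    ∃ x, H.HasStarLebesgueMeasure S x := by
  by_contra! hx
  exact h (iInf₂_eq_top.2 fun x hS => (hx x hS).elim)

variable (H) in
theorem loebOuterMeasure_Icc_le {a b : F} (hab : a ≤ b) :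
    H.loebOuterMeasure (Icc a b) ≤ (shadow H.std (b - a)).toENNReal :=
  (OuterMeasure.ofFunction_le _).trans (loebContent_eq (H.hasStarLebesgueMeasure_Icc hab)).le

-- Each interval of a covering may be replaced by the closed one with the same endpoints, at no
-- extra cost.
variable (H) in
theorem loebOuterMeasure_le_lOuterMeasure : H.loebOuterMeasure ≤ lOuterMeasure H.std := by
  refine OuterMeasure.le_ofFunction.2 fun S => ?_
  refine le_iInf fun a => le_iInf fun b => le_iInf fun hab => le_iInf fun hS => ?_
  refine (measure_mono ?_).trans (H.loebOuterMeasure_Icc_le hab)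
  rcases hS with rfl | rfl | rfl | rfl
  · exact Subset.rfl
  · exact Ico_subset_Icc_self
  · exact Ioc_subset_Icc_self
  · exact Ioo_subset_Icc_self

/-- Transferred additivity splits each test set of finite `*`measure exactly; superadditivity of the
standard part does the rest. -/
theorem HasStarLebesgueMeasure.loebMeasurableSet {S : Set F} {x : F}
    (hS : H.HasStarLebesgueMeasure S x) : H.LoebMeasurableSet S := by
  refine OuterMeasure.ofFunction_caratheodory fun T => ?_
  by_cases hT : H.loebContent T = ∞
  · rw [hT]
    exact le_top
  obtain ⟨y, hT⟩ := exists_hasStarLebesgueMeasure hT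
  obtain ⟨u, v, hu, hv, rfl⟩ := hT.split hS
  rw [loebContent_eq hT, loebContent_eq hu, loebContent_eq hv]
  exact add_toENNReal_shadow_le _ hu.nonneg hv.nonneg

/-- Only the union of two sets is transferred; standard finite unions follow by induction. -/
theorem exists_hasStarLebesgueMeasure_biUnion_lt {S : ℕ → Set F} {x : ℕ → F}
    (h : ∀ n, H.HasStarLebesgueMeasure (S n) (x n)) (N : ℕ) :
    ∃ y, H.HasStarLebesgueMeasure (⋃ n < N, S n) y ∧ y ≤ ∑ n ∈ Finset.range N, x n := by
  induction N with
  | zero => exact ⟨0, by simpa using H.hasStarLebesgueMeasure_empty, by simp⟩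
  | succ N ih =>
    obtain ⟨y, hy, hle⟩ := ih
    obtain ⟨z, hz, hzle⟩ := hy.union (h N)
    refine ⟨z, by rwa [biUnion_lt_succ], hzle.trans ?_⟩
    rw [Finset.sum_range_succ]
    gcongr

/-- On internal `*`-Lebesgue measurable sets of finite measure, countable saturation makes
`S ↦ st(*λ(S))` countably subadditive. -/
theorem HasStarLebesgueMeasure.le_loebOuterMeasure (hsat : H.CountablySaturated) {S : Set F} {x : F}
    (hS : H.HasStarLebesgueMeasure S x) :
    (shadow H.std x).toENNReal ≤ H.loebOuterMeasure S := by
  rw [loebOuterMeasure, OuterMeasure.ofFunction_apply]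
  refine le_iInf₂ fun T hST => ?_
  by_cases htop : ∃ n, H.loebContent (T n) = ∞
  · obtain ⟨n, hn⟩ := htop
    rw [ENNReal.tsum_eq_top_of_eq_top ⟨n, hn⟩]
    exact le_top
  push Not at htop
  choose y hy using fun n => exists_hasStarLebesgueMeasure (htop n)
  -- Compactness: otherwise the internal sets `S \ T n` have the finite intersection property, and a
  -- common point of them is covered by no `T n`.
  obtain ⟨N, hN⟩ : ∃ N, S ⊆ ⋃ n < N, T n := by
    by_contra! hcon
    have hfip : ∀ N, (⋂ n ≤ N, S \ T n).Nonempty := by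
      intro N
      obtain ⟨z, hz, hzT⟩ := not_subset.1 (hcon (N + 1))
      simp only [mem_iUnion, not_exists] at hzT
      exact ⟨z, mem_iInter₂.2 fun n hn => ⟨hz, hzT n (Nat.lt_succ_of_le hn)⟩⟩
    obtain ⟨z, hz⟩ := hsat _ (fun n => diff_mem_internal hS.1 (hy n).1) hfip
    rw [mem_iInter] at hz
    obtain ⟨n, hn⟩ := mem_iUnion.1 (hST (hz 0).1)
    exact (hz n).2 hn
  obtain ⟨z, hz, hle⟩ := exists_hasStarLebesgueMeasure_biUnion_lt hy N
  calc (shadow H.std x).toENNReal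
      ≤ (shadow H.std (∑ n ∈ Finset.range N, y n)).toENNReal :=
        toENNReal_shadow_mono _ ((hS.mono hz hN).trans hle)
    _ ≤ ∑ n ∈ Finset.range N, (shadow H.std (y n)).toENNReal := toENNReal_shadow_sum_le _ _ _
    _ = ∑ n ∈ Finset.range N, H.loebContent (T n) := by simp only [loebContent_eq (hy _)]
    _ ≤ ∑' n, H.loebContent (T n) := ENNReal.sum_le_tsum _

variable (H) in
theorem loebMeasurableSet_Ico {a b : F} (hab : a ≤ b) : H.LoebMeasurableSet (Ico a b) := by
  -- [a, b) is the internal set [a, b] minus the degenerate interval [b, b].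
  rw [← Icc_sdiff_right, ← Icc_self]
  exact MeasurableSet.diff (H.hasStarLebesgueMeasure_Icc hab).loebMeasurableSet
    (H.hasStarLebesgueMeasure_Icc le_rfl).loebMeasurableSet

/-- The missing endpoint costs nothing, since [b, b] has outer measure zero. -/
theorem le_loebOuterMeasure_Ico (hsat : H.CountablySaturated) {a b : F} (hab : a ≤ b) :
    (shadow H.std (b - a)).toENNReal ≤ H.loebOuterMeasure (Ico a b) := by
  have h0 : H.loebOuterMeasure (Icc b b) ≤ 0 := by
    simpa [toENNReal_shadow_zero] using H.loebOuterMeasure_Icc_le (le_refl b)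
  calc (shadow H.std (b - a)).toENNReal ≤ H.loebOuterMeasure (Icc a b) :=
        (H.hasStarLebesgueMeasure_Icc hab).le_loebOuterMeasure hsat
    _ ≤ H.loebOuterMeasure (Ico a b ∪ Icc b b) := by
        rw [Icc_self, Ico_union_right hab]
    _ ≤ H.loebOuterMeasure (Ico a b) + H.loebOuterMeasure (Icc b b) := measure_union_le _ _
    _ ≤ H.loebOuterMeasure (Ico a b) := by
        rw [nonpos_iff_eq_zero.1 h0, add_zero]

variable (H) in
/-- Every set has a Loeb measurable hull. -/
theorem exists_loebMeasurableSet_superset (A : Set F) : ∃ B, A ⊆ B ∧ H.LoebMeasurableSet B ∧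
    H.loebOuterMeasure B ≤ H.loebOuterMeasure A := by
  by_cases htop : H.loebOuterMeasure A = ∞
  · exact ⟨univ, subset_univ _, MeasurableSet.univ, by simp [htop]⟩
  -- For n = 0 the error term is ∞, which is harmless.
  have hcov : ∀ n : ℕ, ∃ B, A ⊆ B ∧ H.LoebMeasurableSet B ∧
      H.loebOuterMeasure B ≤ H.loebOuterMeasure A + (n : ℝ≥0∞)⁻¹ := by
    intro n
    have hlt : H.loebOuterMeasure A < H.loebOuterMeasure A + (n : ℝ≥0∞)⁻¹ :=
      ENNReal.lt_add_right htop (by simp)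
    conv_lhs at hlt => rw [loebOuterMeasure, OuterMeasure.ofFunction_apply]
    obtain ⟨T, hT⟩ := iInf_lt_iff.1 hlt
    obtain ⟨hAT, hT⟩ := iInf_lt_iff.1 hT
    refine ⟨⋃ n, T n, hAT, MeasurableSet.iUnion fun k => ?_, ?_⟩
    -- A finite sum excludes the default value ∞, so every `T k` is internal and `*`Lebesgue
    -- measurable.
    · obtain ⟨x, hx⟩ := exists_hasStarLebesgueMeasure
        (ENNReal.ne_top_of_tsum_ne_top (hT.trans_le le_top).ne k)
      exact hx.loebMeasurableSet
    · exact (measure_iUnion_le _).trans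
        ((ENNReal.tsum_le_tsum fun k => OuterMeasure.ofFunction_le _).trans hT.le)
  choose B hAB hB hle using hcov
  refine ⟨⋂ n, B n, subset_iInter hAB, MeasurableSet.iInter hB, ?_⟩
  refine ge_of_tendsto' (x := Filter.atTop)
    (f := fun n : ℕ => H.loebOuterMeasure A + (n : ℝ≥0∞)⁻¹) ?_
    fun n => (measure_mono (iInter_subset B n)).trans (hle n)
  simpa using ENNReal.tendsto_inv_nat_nhds_zero.const_add (H.loebOuterMeasure A)

/-- Sets of outer measure zero are Loeb measurable. -/
theorem loebMeasurableSet_of_null {A : Set F} (h : H.loebOuterMeasure A = 0) :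
    H.LoebMeasurableSet A :=
  (OuterMeasure.isCaratheodory_iff_le _).2 fun t => by
    rw [measure_mono_null inter_subset_right h, zero_add]
    exact measure_mono sdiff_subset

/-- A set that splits a Loeb measurable set of finite measure additively is Loeb measurable. -/
theorem LoebMeasurableSet.of_add_le {A J : Set F} (hAJ : A ⊆ J) (hJ : H.LoebMeasurableSet J)
    (hfin : H.loebOuterMeasure J ≠ ∞)
    (h : H.loebOuterMeasure A + H.loebOuterMeasure (J \ A) ≤ H.loebOuterMeasure J) :
    H.LoebMeasurableSet A := by
  obtain ⟨B, hAB, hB, hBle⟩ := H.exists_loebMeasurableSet_superset A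
  obtain ⟨C, hJC, hC, hCle⟩ := H.exists_loebMeasurableSet_superset (J \ A)
  have hcar := fun t => (OuterMeasure.isCaratheodory_iff _).1 hB t
  -- the hulls overlap in a null set
  have hJB : H.loebOuterMeasure (J \ B) + H.loebOuterMeasure (C ∩ B) ≤ H.loebOuterMeasure C := by
    rw [hcar C, add_comm (H.loebOuterMeasure (J \ B))]
    exact add_le_add le_rfl
      (measure_mono fun z hz => ⟨hJC ⟨hz.1, fun hA => hz.2 (hAB hA)⟩, hz.2⟩)
  have hJ' : H.loebOuterMeasure J ≤ H.loebOuterMeasure B + H.loebOuterMeasure (J \ B) := by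
    rw [hcar J]
    exact add_le_add (measure_mono inter_subset_right) le_rfl
  have hnull : H.loebOuterMeasure (C ∩ B) = 0 := by
    have h1 : H.loebOuterMeasure J + H.loebOuterMeasure (C ∩ B) ≤ H.loebOuterMeasure J + 0 :=
      calc H.loebOuterMeasure J + H.loebOuterMeasure (C ∩ B)
          ≤ H.loebOuterMeasure B + (H.loebOuterMeasure (J \ B) + H.loebOuterMeasure (C ∩ B)) := by
            rw [← add_assoc]
            gcongr
        _ ≤ H.loebOuterMeasure A + H.loebOuterMeasure (J \ A) :=
            add_le_add hBle (hJB.trans hCle)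
        _ ≤ H.loebOuterMeasure J + 0 := by rwa [add_zero]
    exact nonpos_iff_eq_zero.1 ((ENNReal.add_le_add_iff_left hfin).1 h1)
  -- A is the measurable set B ∩ J minus a null set: a point of B ∩ J outside A lies in J \ A ⊆ C,
  -- hence in C ∩ B.
  have hA : A = (B ∩ J) \ ((B ∩ J) \ A) := by
    rw [Set.sdiff_sdiff_right_self]
    exact (inter_eq_right.2 (subset_inter hAB hAJ)).symm
  rw [hA]
  refine MeasurableSet.diff (MeasurableSet.inter hB hJ)
    (loebMeasurableSet_of_null (measure_mono_null ?_ hnull))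
  exact fun z hz => ⟨hJC ⟨hz.1.2, hz.2⟩, hz.1.1⟩

/-- The sandwich argument. Standard endpoints keep the measure of J finite, so that terms can be
cancelled. -/
theorem loebMeasurableSet_and_eq_of_subset_Ico (hsat : H.CountablySaturated) {A : Set F} {r s : ℝ}
    (hrs : r ≤ s) (hsub : A ⊆ Ico (H.std r) (H.std s)) (hA : LMeasurableSet H.std A) :
    H.LoebMeasurableSet A ∧ lOuterMeasure H.std A = H.loebOuterMeasure A := by
  set J := Ico (H.std r) (H.std s)
  have hab : H.std r ≤ H.std s := OrderHomClass.mono H.std hrs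
  have hle := H.loebOuterMeasure_le_lOuterMeasure
  have hm : lOuterMeasure H.std A + lOuterMeasure H.std (J \ A) ≤ H.loebOuterMeasure J := by
    have h := (OuterMeasure.isCaratheodory_iff _).1 hA J
    rw [inter_eq_right.2 hsub] at h
    rw [← h]
    exact (lOuterMeasure_Ico_le _ hab).trans (le_loebOuterMeasure_Ico hsat hab)
  have hfin : H.loebOuterMeasure J ≠ ∞ := by
    refine ne_top_of_le_ne_top ?_ ((hle J).trans (lOuterMeasure_Ico_le _ hab))
    rw [← map_sub]
    exact ne_top_of_le_ne_top ENNReal.ofReal_ne_top (toENNReal_shadow_le _ le_rfl)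
  refine ⟨.of_add_le hsub (H.loebMeasurableSet_Ico hab) hfin
    ((add_le_add (hle _) (hle _)).trans hm), le_antisymm ?_ (hle A)⟩
  have hfin' : H.loebOuterMeasure (J \ A) ≠ ∞ :=
    ne_top_of_le_ne_top hfin (measure_mono sdiff_subset)
  refine (ENNReal.add_le_add_iff_right hfin').1 ?_
  calc lOuterMeasure H.std A + H.loebOuterMeasure (J \ A)
      ≤ lOuterMeasure H.std A + lOuterMeasure H.std (J \ A) := by gcongr
    _ ≤ H.loebOuterMeasure J := hm
    _ ≤ H.loebOuterMeasure (A ∪ J \ A) := measure_mono (by rw [union_sdiff_cancel hsub])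
    _ ≤ H.loebOuterMeasure A + H.loebOuterMeasure (J \ A) := measure_union_le _ _

end HyperrealField

/-! ### Exhaustion of the finite elements -/

theorem mainTheorem5 {F : Type*} [Field F] [LinearOrder F] [IsStrictOrderedRing F]
    (H : HyperrealField F) (hsat : H.CountablySaturated)
    (A : Set F) (hfin : A ⊆ finiteElements H.std) (hA : LMeasurableSet H.std A) :
    H.LoebMeasurableSet A ∧ lMeasure H.std A = H.loebMeasure A := by
  have hcut : ∀ n : ℕ, LMeasurableSet H.std (A ∩ Ico (H.std (-n)) (H.std n)) := fun n =>
    MeasurableSet.inter hA (lMeasurableSet_Ico _ _ _)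
  have hloc := fun n : ℕ => H.loebMeasurableSet_and_eq_of_subset_Ico hsat
    (neg_le_self n.cast_nonneg) inter_subset_right (hcut n)
  have hU : A = ⋃ n : ℕ, A ∩ Ico (H.std (-n)) (H.std n) := by
    rw [← inter_iUnion, inter_eq_left.2 (hfin.trans (finiteElements_subset_iUnion_Ico _))]
  have hmono : Monotone fun n : ℕ => A ∩ Ico (H.std (-n)) (H.std n) := by
    intro m n hmn
    have hmn' : (m : ℝ) ≤ n := by exact_mod_cast hmn
    exact inter_subset_inter_right _ (Ico_subset_Ico
      (OrderHomClass.mono H.std (neg_le_neg hmn')) (OrderHomClass.mono H.std hmn'))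
  refine ⟨?_, ?_⟩
  · rw [hU]
    exact MeasurableSet.iUnion fun n => (hloc n).1
  · rw [hU, @Monotone.measure_iUnion F ℕ (lOuterMeasure H.std).caratheodory (lMeasure H.std) _ _ _
      _ hmono, @Monotone.measure_iUnion F ℕ H.loebOuterMeasure.caratheodory H.loebMeasure _ _ _ _
      hmono]
    refine iSup_congr fun n => ?_
    exact (@toMeasure_apply F (lOuterMeasure H.std).caratheodory _ le_rfl _ (hcut n)).trans
      ((hloc n).2.trans
        (@toMeasure_apply F H.loebOuterMeasure.caratheodory _ le_rfl _ (hloc n).1).symm)
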